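/- Let $n,d$ be natural numbers and let $\mathcal K(\rho)=\sum_{j=1}^d K_j\rho K_j^\dagger$ be a quantum channel on $n\times n$ matrices, with Kraus operators $K_j\in\mathbb C^{n\times n}$ satisfying $\sum_j K_j^\dagger K_j=I$. Let $F(\rho,\sigma)=\operatorname{Tr}\sqrt{\rho^{1/2}\sigma\rho^{1/2}}$ be the fidelity, and let $$F_{\min}(\mathcal K)=\min_{|\Psi\rangle_{AB}}F\big(|\Psi\rangle\langle\Psi|,(I_A\otimes\mathcal K_B)(|\Psi\rangle\langle\Psi|)\big)$$ be the minimum entanglement fidelity, the minimum being over all unit vectors $|\Psi\rangle\in\mathbb C^k\otimes\mathbb C^n$ with an ancilla $A$ of any finite dimension $k$. For a unitary matrix $U$ with eigenvalues $e^{-i\theta_j}$, $\theta_j\in(-\pi,\pi]$, let $\|U\|=\max_j|\theta_j|$, and let the time-energy cost $\|\mathcal K\|$ be the minimum of $\|U\|$ over all unitary extensions of $\mathcal K$, i.e. over all unitaries $U$ on $C\otimes B$, with an ancilla $C$ of any finite dimension $\ge 1$, such that $\mathcal K(\rho)=\operatorname{Tr}_C[U(|0\rangle\langle 0|_C\otimes\rho)U^\dagger]$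 for all density matrices $\rho$ on $B=\mathbb C^n$. If $F_{\min}(\mathcal K)>0$ (with $F_{\min}$ and $\|\mathcal K\|$ read as infima), then both minima are attained and $$F_{\min}(\mathcal K)=\cos\|\mathcal K\| .$$ Moreover, for every minimizing $|\Psi\rangle_{AB}$, with reduced state $\tilde\rho=\operatorname{Tr}_A|\Psi\rangle\langle\Psi|$ and weights $\tilde w_i=\overline{\operatorname{Tr}(\tilde\rho K_i)}\big/\sqrt{\sum_j|\operatorname{Tr}(\tilde\rho K_j)|^2}$, $$F_{\min}(\mathcal K)=\min_{|\psi\rangle}\operatorname{Re}\langle\psi|\sum_i\tilde w_iK_i|\psi\rangle ,$$ where the minimum is over all unit vectors $|\psi\rangle\in\mathbb C^n$ and is attained. -/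

import Mathlib

open scoped Matrix ComplexOrder MatrixOrder Kronecker

namespace TimeEnergy

noncomputable section

/-- A density matrix: positive semidefinite with unit trace. -/
def IsDensity {ι : Type*} [Fintype ι] (ρ : Matrix ι ι ℂ) : Prop :=
  ρ.PosSemidef ∧ ρ.trace = 1

/-- A normalized pure state (a unit vector of `ℂ^ι`, Hermitian norm). -/
def IsState {ι : Type*} [Fintype ι] (ψ : ι → ℂ) : Prop :=
  star ψ ⬝ᵥ ψ = 1

/-- The rank-one operator `|ψ⟩⟨ψ|`. -/
def ketbra {ι : Type*} (ψ : ι → ℂ) : Matrix ι ι ℂ :=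
  Matrix.vecMulVec ψ (star ψ)

/-- The expectation `⟨ψ| M |ψ⟩`. -/
def expect {ι : Type*} [Fintype ι] (ψ : ι → ℂ) (M : Matrix ι ι ℂ) : ℂ :=
  star ψ ⬝ᵥ (M *ᵥ ψ)

/-- Partial trace over the first tensor factor. -/
def trFst {α β : Type*} [Fintype α] (M : Matrix (α × β) (α × β) ℂ) : Matrix β β ℂ :=
  Matrix.of fun b b' => ∑ a, M (a, b) (a, b')

/-- The Uhlmann fidelity `Tr √(ρ^{1/2} σ ρ^{1/2})` (not squared). -/
def fidelity {ι : Type*} [Fintype ι] [DecidableEq ι] (ρ σ : Matrix ι ι ℂ) : ℝ :=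
  (CFC.sqrt (CFC.sqrt ρ * σ * CFC.sqrt ρ)).trace.re

/-- The linear map `ρ ↦ ∑ j, K_j ρ K_j†` with Kraus operators `K`. -/
def krausMap {d n : ℕ} (K : Fin d → Matrix (Fin n) (Fin n) ℂ) :
    Matrix (Fin n) (Fin n) ℂ →ₗ[ℂ] Matrix (Fin n) (Fin n) ℂ where
  toFun ρ := ∑ j, K j * ρ * (K j)ᴴ
  map_add' ρ σ := by
    simp only [mul_add, add_mul, Finset.sum_add_distrib]
  map_smul' c ρ := by
    simp only [Matrix.mul_smul, Matrix.smul_mul, Finset.smul_sum, RingHom.id_apply]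

/-- `I_A ⊗ Φ`: the map `Φ` applied to every block `(a, a')` of a matrix on `A ⊗ B`. -/
def idTensor {α : Type*} {n : ℕ}
    (Φ : Matrix (Fin n) (Fin n) ℂ →ₗ[ℂ] Matrix (Fin n) (Fin n) ℂ)
    (M : Matrix (α × Fin n) (α × Fin n) ℂ) : Matrix (α × Fin n) (α × Fin n) ℂ :=
  Matrix.of fun p q => Φ (Matrix.of fun b b' => M (p.1, b) (q.1, b')) p.2 q.2

/-- The fidelity between the joint pure input `Ψ` on `A ⊗ B` and its image under `I_A ⊗ Φ`. -/
def inOutFidelity {k n : ℕ}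
    (Φ : Matrix (Fin n) (Fin n) ℂ →ₗ[ℂ] Matrix (Fin n) (Fin n) ℂ)
    (Ψ : Fin k × Fin n → ℂ) : ℝ :=
  fidelity (ketbra Ψ) (idTensor Φ (ketbra Ψ))

/-- All input-output fidelities of `Φ`, the ancilla `A` having any finite dimension `k`. -/
def fidelities {n : ℕ}
    (Φ : Matrix (Fin n) (Fin n) ℂ →ₗ[ℂ] Matrix (Fin n) (Fin n) ℂ) : Set ℝ :=
  {f | ∃ (k : ℕ) (Ψ : Fin k × Fin n → ℂ), IsState Ψ ∧ f = inOutFidelity Φ Ψ}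

/-- The minimum entanglement fidelity `F_min`. -/
def Fmin {n : ℕ}
    (Φ : Matrix (Fin n) (Fin n) ℂ →ₗ[ℂ] Matrix (Fin n) (Fin n) ℂ) : ℝ :=
  sInf (fidelities Φ)

/-- The time-energy cost of a unitary matrix: the largest `|θ|`, where `exp(-iθ)` runs over the
eigenvalues and angles are taken in `(-π, π]`. -/
def unitaryCost {ι : Type*} [Fintype ι] [DecidableEq ι] (U : Matrix ι ι ℂ) : ℝ :=
  sSup {t | ∃ θ ∈ Set.Ioc (-Real.pi) Real.pi,
    Module.End.HasEigenvalue (Matrix.toLin' U) (Complex.exp (-(Complex.I * θ))) ∧ t = |θ|}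

/-- `U` on `C ⊗ B` is a unitary extension of `Φ`, with the ancilla `C` (of dimension `m + 1`)
prepared in the basis state `|0⟩`. -/
def IsUnitaryExtension {m n : ℕ}
    (Φ : Matrix (Fin n) (Fin n) ℂ →ₗ[ℂ] Matrix (Fin n) (Fin n) ℂ)
    (U : Matrix (Fin (m + 1) × Fin n) (Fin (m + 1) × Fin n) ℂ) : Prop :=
  U ∈ Matrix.unitaryGroup (Fin (m + 1) × Fin n) ℂ ∧
    ∀ ρ : Matrix (Fin n) (Fin n) ℂ, IsDensity ρ →
      Φ ρ = trFst (U * (ketbra (Pi.single (0 : Fin (m + 1)) (1 : ℂ)) ⊗ₖ ρ) * Uᴴ)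

/-- The costs of all unitary extensions of `Φ`, the ancilla `C` having any finite dimension. -/
def extensionCosts {n : ℕ}
    (Φ : Matrix (Fin n) (Fin n) ℂ →ₗ[ℂ] Matrix (Fin n) (Fin n) ℂ) : Set ℝ :=
  {t | ∃ (m : ℕ) (U : Matrix (Fin (m + 1) × Fin n) (Fin (m + 1) × Fin n) ℂ),
    IsUnitaryExtension Φ U ∧ t = unitaryCost U}

/-- The time-energy cost of a channel: the smallest cost of a unitary extension. -/
def channelCost {n : ℕ}
    (Φ : Matrix (Fin n) (Fin n) ℂ →ₗ[ℂ] Matrix (Fin n) (Fin n) ℂ) : ℝ :=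
  sInf (extensionCosts Φ)

/-- The unit weight vector `w_i = conj Tr(ρ K_i) / √(∑ j, |Tr(ρ K_j)|²)`, which maximizes
`|∑ i, w_i Tr(ρ K_i)|` (and makes the sum real and nonnegative) when the denominator is nonzero. -/
def optWeight {d n : ℕ} (ρ : Matrix (Fin n) (Fin n) ℂ)
    (K : Fin d → Matrix (Fin n) (Fin n) ℂ) (i : Fin d) : ℂ :=
  star (ρ * K i).trace / (Real.sqrt (∑ j, ‖(ρ * K j).trace‖ ^ 2) : ℂ)

end

end TimeEnergy

open scoped Matrix ComplexOrder MatrixOrder Kronecker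

/-! The fidelity of an input with reduced state `ρ` is the norm of the vector `(Tr ρ K_j)_j`
(`inOutFidelity_krausMap`). Every density matrix is such a reduced state, so `Fmin` is the distance
from the origin to a compact convex set, and it is attained. The variational inequality at a nearest
point says that `M = ∑ w̃_i K_i` satisfies `Re Tr(σ M) ≥ Fmin` for all states `σ`, with equality at
the minimizer. This gives the last formula.

Every extension costs at least `arccos Fmin`: the block `L₀ = ⟨0|U|0⟩` is a Kraus operator of the
same channel, so the fidelity is at least `Re Tr(ρ L₀)`. This is at least `cos ‖U‖`, since the
numerical range of `U` lies in the convex hull of its spectrum.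

Conversely, mix the Kraus operators by a unitary so that `M` becomes the zeroth one. An extension is
then a unitary `U` with `U J = V`, for `J` the embedding at `|0⟩` and `V` the Stinespring isometry,
and `Re (Jᴴ V) ≥ Fmin`. Writing `U` as the Cayley transform of a Hermitian `T`, the constraint
prescribes `T` on the range of `J + V` as a symmetric operator of norm at most `tan(½ arccos Fmin)`.
Krein's theorem extends it to the whole space with the same bound, and that bound keeps the spectrum
of `U` within `Re z ≥ Fmin`. -/

namespace TimeEnergy

/-! ### Rank-one projectors and fidelity with a pure state. -/

section PureStates

variable {ι : Type*} [Fintype ι]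

theorem ketbra_posSemidef (ψ : ι → ℂ) : (ketbra ψ).PosSemidef :=
  Matrix.posSemidef_vecMulVec_self_star ψ

theorem trace_mul_ketbra (M : Matrix ι ι ℂ) (ψ : ι → ℂ) :
    (M * ketbra ψ).trace = expect ψ M := by
  rw [ketbra, expect, Matrix.mul_vecMulVec, Matrix.trace_vecMulVec, dotProduct_comm]

theorem isDensity_ketbra {ψ : ι → ℂ} (hψ : IsState ψ) : IsDensity (ketbra ψ) := by
  refine ⟨ketbra_posSemidef ψ, ?_⟩
  rw [ketbra, Matrix.trace_vecMulVec, dotProduct_comm]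
  exact hψ

theorem ketbra_mul_mul_ketbra (ψ : ι → ℂ) (M : Matrix ι ι ℂ) :
    ketbra ψ * M * ketbra ψ = expect ψ M • ketbra ψ := by
  rw [ketbra, expect, Matrix.vecMulVec_mul, Matrix.vecMulVec_mul_vecMulVec,
    Matrix.dotProduct_mulVec, Matrix.vecMulVec_smul]

theorem ketbra_mul_self [DecidableEq ι] {ψ : ι → ℂ} (hψ : IsState ψ) :
    ketbra ψ * ketbra ψ = ketbra ψ := by
  have h := ketbra_mul_mul_ketbra ψ 1
  rw [mul_one, expect, Matrix.one_mulVec, hψ, one_smul] at h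
  exact h

/-- With `P = ketbra ψ` a projector, `√P = P` and `P σ P = r P`, whose square root is `√r P`. -/
theorem fidelity_ketbra [DecidableEq ι] {ψ : ι → ℂ} (hψ : IsState ψ) {σ : Matrix ι ι ℂ} {r : ℝ}
    (hr : 0 ≤ r) (h : expect ψ σ = r) : fidelity (ketbra ψ) σ = √r := by
  have hk : CFC.sqrt (ketbra ψ) = ketbra ψ :=
    CFC.sqrt_unique (ketbra_mul_self hψ) (Matrix.nonneg_iff_posSemidef.2 (ketbra_posSemidef ψ))
  have hs : CFC.sqrt ((r : ℂ) • ketbra ψ) = ((√r : ℝ) : ℂ) • ketbra ψ := by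
    refine CFC.sqrt_unique ?_ (Matrix.nonneg_iff_posSemidef.2 ?_)
    · rw [smul_mul_smul_comm, ketbra_mul_self hψ, ← Complex.ofReal_mul, Real.mul_self_sqrt hr]
    · exact (ketbra_posSemidef ψ).smul (by exact_mod_cast Real.sqrt_nonneg r)
  rw [fidelity, hk, ketbra_mul_mul_ketbra, h, hs, Matrix.trace_smul, (isDensity_ketbra hψ).2]
  simp

theorem expect_sum {κ : Type*} (s : Finset κ) (ψ : ι → ℂ) (M : κ → Matrix ι ι ℂ) :
    expect ψ (∑ j ∈ s, M j) = ∑ j ∈ s, expect ψ (M j) := by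
  simp only [expect, Matrix.sum_mulVec, dotProduct_sum]

theorem expect_ketbra (ψ φ : ι → ℂ) :
    expect ψ (ketbra φ) = ((‖star ψ ⬝ᵥ φ‖ ^ 2 : ℝ) : ℂ) := by
  rw [expect, ketbra, Matrix.vecMulVec_mulVec, dotProduct_smul]
  have : star φ ⬝ᵥ ψ = star (star ψ ⬝ᵥ φ) := by
    rw [Matrix.star_dotProduct]
  rw [this]
  simp [← Complex.mul_conj']

end PureStates

/-! ### Fidelity as a function of the reduced state; compactness. -/

section ReducedStates

variable {n d : ℕ}

/-- The vector of overlaps `Tr(ρ K_j)`. -/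
noncomputable def overlap (K : Fin d → Matrix (Fin n) (Fin n) ℂ) :
    Matrix (Fin n) (Fin n) ℂ →ₗ[ℂ] EuclideanSpace ℂ (Fin d) where
  toFun ρ := WithLp.toLp 2 fun j => (ρ * K j).trace
  map_add' ρ σ := by ext j; simp [add_mul]
  map_smul' c ρ := by ext j; simp

@[simp]
theorem overlap_apply (K : Fin d → Matrix (Fin n) (Fin n) ℂ) (ρ : Matrix (Fin n) (Fin n) ℂ)
    (j : Fin d) : overlap K ρ j = (ρ * K j).trace := rfl

theorem norm_overlap (K : Fin d → Matrix (Fin n) (Fin n) ℂ) (ρ : Matrix (Fin n) (Fin n) ℂ) :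
    ‖overlap K ρ‖ = √(∑ j, ‖(ρ * K j).trace‖ ^ 2) := by
  simp [EuclideanSpace.norm_eq]

theorem trFst_ketbra {α : Type*} [Fintype α] (Ψ : α × Fin n → ℂ) :
    trFst (ketbra Ψ) = ∑ a, ketbra fun b => Ψ (a, b) := by
  ext b b'
  simp [trFst, ketbra, Matrix.sum_apply, Matrix.vecMulVec_apply]

theorem idTensor_krausMap_ketbra {α : Type*} [Fintype α] (K : Fin d → Matrix (Fin n) (Fin n) ℂ)
    (Ψ : α × Fin n → ℂ) :
    idTensor (krausMap K) (ketbra Ψ) =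
      ∑ j, ketbra fun p => (K j *ᵥ fun b => Ψ (p.1, b)) p.2 := by
  ext p q
  have h : (Matrix.of fun b b' => ketbra Ψ (p.1, b) (q.1, b')) =
      Matrix.vecMulVec (fun b => Ψ (p.1, b)) (star fun b => Ψ (q.1, b)) := by
    ext b b'
    simp [ketbra, Matrix.vecMulVec_apply]
  simp only [idTensor, krausMap, LinearMap.coe_mk, AddHom.coe_mk, Matrix.of_apply, h,
    Matrix.mul_vecMulVec, Matrix.vecMulVec_mul, Matrix.sum_apply, ← Matrix.star_mulVec]
  simp [ketbra, Matrix.vecMulVec_apply]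

theorem star_dotProduct_apply_snd {α : Type*} [Fintype α] (M : Matrix (Fin n) (Fin n) ℂ)
    (Ψ : α × Fin n → ℂ) :
    (star Ψ ⬝ᵥ fun p => (M *ᵥ fun b => Ψ (p.1, b)) p.2) = (trFst (ketbra Ψ) * M).trace := by
  rw [Matrix.trace_mul_comm, trFst_ketbra, Finset.mul_sum, Matrix.trace_sum]
  simp only [trace_mul_ketbra]
  simp [dotProduct, Fintype.sum_prod_type, expect]

theorem inOutFidelity_krausMap {k : ℕ} (K : Fin d → Matrix (Fin n) (Fin n) ℂ)
    {Ψ : Fin k × Fin n → ℂ} (hΨ : IsState Ψ) :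
    inOutFidelity (krausMap K) Ψ = ‖overlap K (trFst (ketbra Ψ))‖ := by
  rw [norm_overlap, inOutFidelity]
  refine fidelity_ketbra hΨ (by positivity) ?_
  rw [idTensor_krausMap_ketbra, expect_sum]
  simp only [expect_ketbra, star_dotProduct_apply_snd]
  push_cast
  rfl

theorem isDensity_trFst_ketbra {α : Type*} [Fintype α] {Ψ : α × Fin n → ℂ} (hΨ : IsState Ψ) :
    IsDensity (trFst (ketbra Ψ)) := by
  classical
  constructor
  · rw [trFst_ketbra]
    exact Matrix.posSemidef_sum _ fun a _ => ketbra_posSemidef _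
  · have h := star_dotProduct_apply_snd 1 Ψ
    simp only [Matrix.one_mulVec, mul_one] at h
    rw [← h]
    exact hΨ

theorem IsDensity.exists_purification {ρ : Matrix (Fin n) (Fin n) ℂ} (hρ : IsDensity ρ) :
    ∃ Ψ : Fin n × Fin n → ℂ, IsState Ψ ∧ trFst (ketbra Ψ) = ρ := by
  have h0 : 0 ≤ ρ := Matrix.nonneg_iff_posSemidef.2 hρ.1
  have hs : (CFC.sqrt ρ).IsHermitian :=
    (Matrix.nonneg_iff_posSemidef.1 (CFC.sqrt_nonneg ρ)).isHermitian
  -- The purification is the vectorization of `√ρ`.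
  have hred : trFst (ketbra fun p : Fin n × Fin n => CFC.sqrt ρ p.2 p.1) = ρ := by
    conv_rhs => rw [← CFC.sqrt_mul_sqrt_self ρ h0]
    ext b b'
    simp only [trFst, ketbra, Matrix.vecMulVec_apply, Matrix.of_apply, Matrix.mul_apply,
      Pi.star_apply]
    exact Finset.sum_congr rfl fun a _ => by rw [hs.apply]
  refine ⟨_, ?_, hred⟩
  have h := star_dotProduct_apply_snd 1 fun p : Fin n × Fin n => CFC.sqrt ρ p.2 p.1
  rw [hred, mul_one, hρ.2] at h
  simp only [Matrix.one_mulVec] at h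
  exact h

theorem isCompact_setOf_isState {ι : Type*} [Fintype ι] : IsCompact {ψ : ι → ℂ | IsState ψ} := by
  have h : {ψ : ι → ℂ | IsState ψ} =
      (WithLp.toLp 2 : (ι → ℂ) → EuclideanSpace ℂ ι) ⁻¹' Metric.sphere 0 1 := by
    ext ψ
    have h1 : star ψ ⬝ᵥ ψ = ((‖WithLp.toLp 2 ψ‖ ^ 2 : ℝ) : ℂ) := by
      rw [EuclideanSpace.norm_sq_eq]
      simp [dotProduct, Complex.conj_mul']
    rw [Set.mem_ofPred_eq, IsState, h1, Set.mem_preimage, mem_sphere_zero_iff_norm]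
    norm_cast
    exact pow_eq_one_iff_of_nonneg (norm_nonneg _) two_ne_zero
  rw [h]
  exact (PiLp.continuousLinearEquiv 2 ℂ fun _ : ι => ℂ).symm.toHomeomorph.isCompact_preimage.2
    (isCompact_sphere _ _)

theorem setOf_isDensity_eq_image :
    {ρ : Matrix (Fin n) (Fin n) ℂ | IsDensity ρ} =
      (fun Ψ : Fin n × Fin n → ℂ => trFst (ketbra Ψ)) '' {Ψ | IsState Ψ} := by
  ext ρ
  constructor
  · intro h
    exact h.exists_purification
  · rintro ⟨Ψ, hΨ, rfl⟩
    exact isDensity_trFst_ketbra hΨ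

theorem isCompact_setOf_isDensity :
    IsCompact {ρ : Matrix (Fin n) (Fin n) ℂ | IsDensity ρ} := by
  rw [setOf_isDensity_eq_image]
  refine isCompact_setOf_isState.image ?_
  simp only [trFst, ketbra, Matrix.vecMulVec_apply, Pi.star_apply]
  fun_prop

theorem fidelities_krausMap (K : Fin d → Matrix (Fin n) (Fin n) ℂ) :
    fidelities (krausMap K) = (fun ρ => ‖overlap K ρ‖) '' {ρ | IsDensity ρ} := by
  ext f
  constructor
  · rintro ⟨k, Ψ, hΨ, rfl⟩
    exact ⟨_, isDensity_trFst_ketbra hΨ, (inOutFidelity_krausMap K hΨ).symm⟩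
  · rintro ⟨ρ, hρ, rfl⟩
    obtain ⟨Ψ, hΨ, rfl⟩ := hρ.exists_purification
    exact ⟨n, Ψ, hΨ, (inOutFidelity_krausMap K hΨ).symm⟩

/-- The fidelities are a continuous image of the compact set of states. Nonemptiness can fail: there
are no states when `n = 0`. -/
theorem isLeast_Fmin_of_nonempty (K : Fin d → Matrix (Fin n) (Fin n) ℂ)
    (h : (fidelities (krausMap K)).Nonempty) :
    IsLeast (fidelities (krausMap K)) (Fmin (krausMap K)) := by
  have hc : IsCompact (fidelities (krausMap K)) := by
    rw [fidelities_krausMap]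
    exact isCompact_setOf_isDensity.image (overlap K).continuous_of_finiteDimensional.norm
  exact hc.isLeast_sInf h

end ReducedStates

/-! ### First-order optimality of the minimizing state. -/

section Optimality

variable {n d : ℕ}

theorem IsDensity.convexCombination {ι : Type*} [Fintype ι] {ρ σ : Matrix ι ι ℂ}
    (hρ : IsDensity ρ) (hσ : IsDensity σ) {t : ℝ} (h0 : 0 ≤ t) (h1 : t ≤ 1) :
    IsDensity (ρ + (t : ℂ) • (σ - ρ)) := by
  have h : ρ + (t : ℂ) • (σ - ρ) = ((1 - t : ℝ) : ℂ) • ρ + (t : ℂ) • σ := by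
    push_cast
    module
  rw [h]
  constructor
  · exact (hρ.1.smul (by exact_mod_cast sub_nonneg.2 h1)).add
      (hσ.1.smul (by exact_mod_cast h0))
  · simp [Matrix.trace_add, Matrix.trace_smul, hρ.2, hσ.2]

/-- The nearest-point inequality: otherwise `‖·‖²` would decrease to first order when moving from
`x` towards `y`. -/
theorem sq_norm_le_re_inner_of_forall_norm_le {E : Type*} [NormedAddCommGroup E]
    [InnerProductSpace ℂ E] {x y : E}
    (h : ∀ t : ℝ, 0 ≤ t → t ≤ 1 → ‖x‖ ≤ ‖x + (t : ℂ) • (y - x)‖) :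
    ‖x‖ ^ 2 ≤ (inner ℂ x y).re := by
  set a : ℝ := (inner ℂ x (y - x)).re with ha
  have ha' : a = (inner ℂ x y).re - ‖x‖ ^ 2 := by
    rw [ha, inner_sub_right, inner_self_eq_norm_sq_to_K]
    simp [← Complex.ofReal_pow]
  by_contra! hlt
  have hneg : a < 0 := by linarith
  have key : ∀ t : ℝ, 0 ≤ t → t ≤ 1 → 0 ≤ 2 * t * a + t ^ 2 * ‖y - x‖ ^ 2 := by
    intro t h0 h1
    have h2 := pow_le_pow_left₀ (norm_nonneg _) (h t h0 h1) 2
    rw [@norm_add_sq ℂ, inner_smul_right, norm_smul] at h2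
    simp only [RCLike.re_eq_complex_re, Complex.re_ofReal_mul, Complex.norm_real, mul_pow,
      Real.norm_eq_abs, sq_abs] at h2
    rw [← ha] at h2
    linarith
  have hb : 0 ≤ ‖y - x‖ ^ 2 := by positivity
  set b := ‖y - x‖ ^ 2
  have hd : 0 < b - a := by linarith
  -- This `t` lies in `[0, 1]` and makes the quadratic negative, without a separate case for `b =
  -- 0`.
  have := key (-a / (b - a)) (by apply div_nonneg <;> linarith)
    ((div_le_one hd).2 (by linarith))
  have h3 : 2 * (-a / (b - a)) * a + (-a / (b - a)) ^ 2 * b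
      = (a ^ 2 * (2 * a - b)) / (b - a) ^ 2 := by
    field_simp
    ring
  rw [h3] at this
  have h4 : a ^ 2 * (2 * a - b) / (b - a) ^ 2 < 0 := by
    apply div_neg_of_neg_of_pos
    · apply mul_neg_of_pos_of_neg
      · exact sq_pos_of_neg hneg
      · linarith
    · positivity
  linarith

/-- The optimal weights turn the trace into pairing with the unit vector along `overlap K ρ`, which
links the operator to the nearest-point inequality. -/
theorem trace_mul_sum_optWeight (K : Fin d → Matrix (Fin n) (Fin n) ℂ)
    (ρ σ : Matrix (Fin n) (Fin n) ℂ) :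
    (σ * ∑ i, optWeight ρ K i • K i).trace =
      inner ℂ (overlap K ρ) (overlap K σ) / (‖overlap K ρ‖ : ℂ) := by
  rw [PiLp.inner_apply, Finset.mul_sum, Matrix.trace_sum, Finset.sum_div, norm_overlap]
  refine Finset.sum_congr rfl fun i _ => ?_
  rw [Matrix.mul_smul, Matrix.trace_smul, optWeight]
  simp only [overlap_apply, RCLike.inner_apply, smul_eq_mul, Complex.star_def]
  ring

theorem norm_overlap_le_re_trace {K : Fin d → Matrix (Fin n) (Fin n) ℂ}
    {ρ σ : Matrix (Fin n) (Fin n) ℂ} (hρ : IsDensity ρ) (hσ : IsDensity σ)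
    (hpos : 0 < ‖overlap K ρ‖)
    (hmin : ∀ τ, IsDensity τ → ‖overlap K ρ‖ ≤ ‖overlap K τ‖) :
    ‖overlap K ρ‖ ≤ (σ * ∑ i, optWeight ρ K i • K i).trace.re := by
  have h : ‖overlap K ρ‖ ^ 2 ≤ (inner ℂ (overlap K ρ) (overlap K σ)).re := by
    refine sq_norm_le_re_inner_of_forall_norm_le fun t h0 h1 => ?_
    have := hmin _ (hρ.convexCombination hσ h0 h1)
    simpa only [map_add, map_smul, map_sub] using this
  rw [trace_mul_sum_optWeight, Complex.div_ofReal_re, le_div_iff₀ hpos]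
  linarith

theorem exists_isState_smul {ι : Type*} [Fintype ι] {φ : ι → ℂ} (hφ : φ ≠ 0) :
    ∃ (r : ℝ) (ψ : ι → ℂ), 0 < r ∧ IsState ψ ∧ φ = (r : ℂ) • ψ := by
  have h1 : star φ ⬝ᵥ φ = ((‖WithLp.toLp 2 φ‖ ^ 2 : ℝ) : ℂ) := by
    rw [EuclideanSpace.norm_sq_eq]
    simp [dotProduct, Complex.conj_mul']
  have hr : 0 < ‖WithLp.toLp 2 φ‖ := norm_pos_iff.2 (by simpa using hφ)
  set r := ‖WithLp.toLp 2 φ‖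
  have hr' : (r : ℂ) ≠ 0 := by exact_mod_cast hr.ne'
  refine ⟨r, (r : ℂ)⁻¹ • φ, hr, ?_, by rw [smul_inv_smul₀ hr']⟩
  rw [IsState, star_smul, smul_dotProduct, dotProduct_smul, h1]
  simp
  field_simp

theorem expect_ofReal_smul {ι : Type*} [Fintype ι] (r : ℝ) (ψ : ι → ℂ) (M : Matrix ι ι ℂ) :
    expect ((r : ℂ) • ψ) M = ((r ^ 2 : ℝ) : ℂ) * expect ψ M := by
  simp only [expect, star_smul, Matrix.mulVec_smul, smul_dotProduct, dotProduct_smul]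
  simp
  ring

/-- The bound holds at every unit vector, and `Re Tr(ρ M)` equals it. Since `ρ` is a mixture of pure
states, strict inequality at all of them would contradict that average. -/
theorem isLeast_re_expect_optWeight {k : ℕ} {K : Fin d → Matrix (Fin n) (Fin n) ℂ}
    {Ψ : Fin k × Fin n → ℂ} (hΨ : IsState Ψ)
    (hpos : 0 < ‖overlap K (trFst (ketbra Ψ))‖)
    (hmin : ∀ τ, IsDensity τ → ‖overlap K (trFst (ketbra Ψ))‖ ≤ ‖overlap K τ‖) :
    IsLeast {t : ℝ | ∃ ψ : Fin n → ℂ, IsState ψ ∧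
      t = (expect ψ (∑ i, optWeight (trFst (ketbra Ψ)) K i • K i)).re}
      ‖overlap K (trFst (ketbra Ψ))‖ := by
  have hρ := isDensity_trFst_ketbra hΨ
  set ρ := trFst (ketbra Ψ) with hρdef
  set M := ∑ i, optWeight ρ K i • K i with hM
  set F := ‖overlap K ρ‖ with hF
  have lower : ∀ ψ : Fin n → ℂ, IsState ψ → F ≤ (expect ψ M).re := by
    intro ψ hψ
    have := norm_overlap_le_re_trace hρ (isDensity_ketbra hψ) hpos hmin
    rwa [Matrix.trace_mul_comm, trace_mul_ketbra] at this
  refine ⟨?_, ?_⟩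
  swap
  · rintro t ⟨ψ, hψ, rfl⟩
    exact lower ψ hψ
  by_contra hno
  have strict : ∀ ψ : Fin n → ℂ, IsState ψ → F < (expect ψ M).re := fun ψ hψ =>
    lt_of_le_of_ne (lower ψ hψ) fun h => hno ⟨ψ, hψ, h⟩
  -- The slices `Ψ (a, ·)` decompose `ρ` into unnormalized pure states, so no diagonalization is
  -- needed.
  have hdec : ∀ B : Matrix (Fin n) (Fin n) ℂ,
      (ρ * B).trace = ∑ a, expect (fun b => Ψ (a, b)) B := by
    intro B
    rw [Matrix.trace_mul_comm, hρdef, trFst_ketbra, Finset.mul_sum, Matrix.trace_sum]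
    simp only [trace_mul_ketbra]
  have strict' : ∀ φ : Fin n → ℂ, φ ≠ 0 → F * (expect φ 1).re < (expect φ M).re := by
    intro φ hφ
    obtain ⟨r, ψ, hr, hψ, rfl⟩ := exists_isState_smul hφ
    rw [expect_ofReal_smul, expect_ofReal_smul, Complex.re_ofReal_mul, Complex.re_ofReal_mul]
    have h1 : expect ψ (1 : Matrix (Fin n) (Fin n) ℂ) = 1 := by
      rw [expect, Matrix.one_mulVec]
      exact hψ
    rw [h1, Complex.one_re, mul_one, mul_comm]
    exact mul_lt_mul_of_pos_left (strict ψ hψ) (by positivity)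
  have hle : ∀ φ : Fin n → ℂ, F * (expect φ 1).re ≤ (expect φ M).re := by
    intro φ
    by_cases hφ : φ = 0
    · simp [hφ, expect]
    · exact (strict' φ hφ).le
  obtain ⟨a, ha⟩ : ∃ a, (fun b => Ψ (a, b)) ≠ 0 := by
    by_contra! hz
    have h1 := hdec 1
    rw [mul_one, hρ.2] at h1
    simp [hz, expect] at h1
  have hsum : ∑ a, F * (expect (fun b => Ψ (a, b)) 1).re <
      ∑ a, (expect (fun b => Ψ (a, b)) M).re :=
    Finset.sum_lt_sum (fun a _ => hle _) ⟨a, Finset.mem_univ a, strict' _ ha⟩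
  rw [← Finset.mul_sum, ← Complex.re_sum, ← Complex.re_sum, ← hdec, ← hdec, mul_one, hρ.2,
    hM, trace_mul_sum_optWeight, inner_self_eq_norm_sq_to_K] at hsum
  have h2 : ((‖overlap K ρ‖ : ℂ) ^ 2 / (‖overlap K ρ‖ : ℂ)).re = F := by
    rw [← hF, sq, mul_div_assoc, div_self (by exact_mod_cast hpos.ne'), mul_one,
      Complex.ofReal_re]
  simp only [Complex.coe_algebraMap, h2, Complex.one_re, mul_one, lt_irrefl] at hsum

end Optimality

/-! ### Angles of eigenvalues and the numerical range of a unitary. -/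

section UnitarySpectrum

variable {ι : Type*} [Fintype ι]

theorem expect_conjTranspose (v : ι → ℂ) (M : Matrix ι ι ℂ) :
    expect v Mᴴ = star (expect v M) := by
  rw [expect, expect, ← Matrix.star_dotProduct_star, star_star, Matrix.star_mulVec,
    Matrix.dotProduct_mulVec]

theorem expect_of_mulVec_eq_smul {M : Matrix ι ι ℂ} {z : ℂ} {v : ι → ℂ} (h : M *ᵥ v = z • v) :
    expect v M = z * (star v ⬝ᵥ v) := by
  rw [expect, h, dotProduct_smul, smul_eq_mul]

variable [DecidableEq ι]

theorem unitaryCost_nonneg (U : Matrix ι ι ℂ) : 0 ≤ unitaryCost U := by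
  refine Real.sSup_nonneg ?_
  rintro t ⟨θ, -, -, rfl⟩
  exact abs_nonneg θ

theorem abs_le_pi_of_mem_Ioc {θ : ℝ} (h : θ ∈ Set.Ioc (-Real.pi) Real.pi) : |θ| ≤ Real.pi :=
  abs_le.2 ⟨h.1.le, h.2⟩

theorem unitaryCost_le_pi (U : Matrix ι ι ℂ) : unitaryCost U ≤ Real.pi := by
  refine Real.sSup_le ?_ Real.pi_pos.le
  rintro t ⟨θ, h, -, rfl⟩
  exact abs_le_pi_of_mem_Ioc h

theorem exists_angle_of_norm_eq_one {z : ℂ} (hz : ‖z‖ = 1) :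
    ∃ θ ∈ Set.Ioc (-Real.pi) Real.pi, z = Complex.exp (-(Complex.I * θ)) := by
  -- The angle is `-arg z`, except at `z = -1`, where `-π` is outside the half-open interval and `π`
  -- replaces it.
  by_cases h : z.arg = Real.pi
  · refine ⟨Real.pi, ⟨by linarith [Real.pi_pos], le_rfl⟩, ?_⟩
    rw [Complex.arg_eq_pi_iff] at h
    have hz' : z = -1 := by
      have h1 := Complex.abs_re_eq_norm.2 h.2
      rw [hz, abs_of_neg h.1] at h1
      exact Complex.ext (by simp; linarith) (by simp [h.2])
    rw [hz', Complex.exp_neg, mul_comm, Complex.exp_pi_mul_I]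
    norm_num
  · refine ⟨-z.arg, ⟨neg_lt_neg (lt_of_le_of_ne (Complex.arg_le_pi z) h),
      by linarith [Complex.neg_pi_lt_arg z]⟩, ?_⟩
    have h1 := Complex.norm_mul_exp_arg_mul_I z
    rw [hz, Complex.ofReal_one, one_mul] at h1
    conv_lhs => rw [← h1]
    congr 1
    push_cast
    ring

theorem re_exp_neg_I_mul (θ : ℝ) : (Complex.exp (-(Complex.I * θ))).re = Real.cos θ := by
  have : -(Complex.I * θ) = ((-θ : ℝ) : ℂ) * Complex.I := by push_cast; ring
  rw [this, Complex.exp_ofReal_mul_I_re, Real.cos_neg]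

theorem norm_eq_one_of_mulVec_eq_smul {U : Matrix ι ι ℂ} (hU : Uᴴ * U = 1) {z : ℂ} {v : ι → ℂ}
    (hv : v ≠ 0) (h : U *ᵥ v = z • v) : ‖z‖ = 1 := by
  have h1 : star (U *ᵥ v) ⬝ᵥ (U *ᵥ v) = star v ⬝ᵥ v := by
    rw [Matrix.star_mulVec, ← Matrix.dotProduct_mulVec, Matrix.mulVec_mulVec, hU,
      Matrix.one_mulVec]
  rw [h, star_smul, smul_dotProduct, dotProduct_smul, smul_smul, smul_eq_mul] at h1
  have h2 : star v ⬝ᵥ v ≠ 0 := fun h0 => hv (dotProduct_star_self_eq_zero.1 h0)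
  have h3 : star z * z = 1 := mul_right_cancel₀ h2 (by rw [h1, one_mul])
  rw [Complex.star_def, Complex.conj_mul'] at h3
  exact (pow_eq_one_iff_of_nonneg (norm_nonneg _) two_ne_zero).1 (by exact_mod_cast h3)

theorem cos_unitaryCost_le_re {U : Matrix ι ι ℂ} (hU : Uᴴ * U = 1) {z : ℂ} {v : ι → ℂ}
    (hv : v ≠ 0) (h : U *ᵥ v = z • v) : Real.cos (unitaryCost U) ≤ z.re := by
  obtain ⟨θ, hθ, rfl⟩ := exists_angle_of_norm_eq_one (norm_eq_one_of_mulVec_eq_smul hU hv h)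
  rw [re_exp_neg_I_mul, ← Real.cos_abs θ]
  refine Real.cos_le_cos_of_nonneg_of_le_pi (abs_nonneg θ) (unitaryCost_le_pi U) ?_
  refine le_csSup ⟨Real.pi, ?_⟩ ⟨θ, hθ, ?_, rfl⟩
  · rintro t ⟨θ, h, -, rfl⟩
    exact abs_le_pi_of_mem_Ioc h
  · exact Module.End.hasEigenvalue_of_hasEigenvector
      (x := v) ⟨Module.End.mem_eigenspace_iff.2 (by rw [Matrix.toLin'_apply, h]), hv⟩

theorem unitaryCost_le_arccos {U : Matrix ι ι ℂ} {c : ℝ}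
    (h : ∀ (z : ℂ) (v : ι → ℂ), ‖z‖ = 1 → v ≠ 0 → U *ᵥ v = z • v → c ≤ z.re) :
    unitaryCost U ≤ Real.arccos c := by
  refine Real.sSup_le ?_ (Real.arccos_nonneg c)
  rintro t ⟨θ, hθ, hev, rfl⟩
  obtain ⟨v, hv⟩ := hev.exists_hasEigenvector
  have hz : ‖Complex.exp (-(Complex.I * θ))‖ = 1 := by
    have : -(Complex.I * θ) = ((-θ : ℝ) : ℂ) * Complex.I := by push_cast; ring
    rw [this, Complex.norm_exp_ofReal_mul_I]
  have h1 := h _ v hz hv.2 (by simpa using hv.apply_eq_smul)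
  rw [re_exp_neg_I_mul, ← Real.cos_abs] at h1
  rw [← Real.arccos_cos (abs_nonneg θ) (abs_le_pi_of_mem_Ioc hθ)]
  exact Real.antitone_arccos h1

/-- It suffices that `U + Uᴴ ≥ 2 cos ‖U‖`, and every eigenvalue of `U + Uᴴ` is `2 Re z` for some
eigenvalue `z` of `U`. -/
theorem cos_unitaryCost_le_re_expect {U : Matrix ι ι ℂ} (hU : U ∈ Matrix.unitaryGroup ι ℂ)
    {φ : ι → ℂ} (hφ : IsState φ) : Real.cos (unitaryCost U) ≤ (expect φ U).re := by
  have hU1 : Uᴴ * U = 1 := Matrix.mem_unitaryGroup_iff'.1 hU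
  have hU2 : U * Uᴴ = 1 := Matrix.mem_unitaryGroup_iff.1 hU
  set c := Real.cos (unitaryCost U)
  set H := U + Uᴴ with hH
  have hHerm : H.IsHermitian := by
    rw [Matrix.IsHermitian, hH, Matrix.conjTranspose_add, Matrix.conjTranspose_conjTranspose,
      add_comm]
  have hcomm : U * H = H * U := by rw [hH, mul_add, add_mul, hU1, hU2]
  have hA : (H - ((2 * c : ℝ) : ℂ) • (1 : Matrix ι ι ℂ)).IsHermitian := by
    refine hHerm.sub ?_
    rw [Matrix.IsHermitian, Matrix.conjTranspose_smul]
    simp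
  have hpsd : (H - ((2 * c : ℝ) : ℂ) • (1 : Matrix ι ι ℂ)).PosSemidef := by
    rw [hA.posSemidef_iff_eigenvalues_nonneg]
    intro i
    generalize hμ : hA.eigenvalues i = μ
    obtain ⟨x, hx'⟩ : ∃ x : ι → ℂ, x = ⇑(hA.eigenvectorBasis i) := ⟨_, rfl⟩
    have hx : x ≠ 0 := hx' ▸ (WithLp.ofLp_eq_zero 2).ne.2 (hA.eigenvectorBasis.orthonormal.ne_zero i)
    have hxe : H *ᵥ x = ((μ + 2 * c : ℝ) : ℂ) • x := by
      have := hA.mulVec_eigenvectorBasis i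
      rw [← hx', hμ, Matrix.sub_mulVec, Matrix.smul_mulVec, Matrix.one_mulVec,
        sub_eq_iff_eq_add] at this
      rw [this, Complex.ofReal_add, add_smul]
      simp only [Complex.coe_smul]
    -- `U` commutes with `H`, so it preserves this eigenspace and has an eigenvector `y` in it.
    set E := Module.End.eigenspace (Matrix.toLin' H) ((μ + 2 * c : ℝ) : ℂ)
    have hmaps : ∀ y ∈ E, Matrix.toLin' U y ∈ E := by
      intro y hy
      rw [Module.End.mem_eigenspace_iff, Matrix.toLin'_apply] at hy ⊢
      rw [Matrix.toLin'_apply, Matrix.mulVec_mulVec, ← hcomm, ← Matrix.mulVec_mulVec, hy,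
        Matrix.mulVec_smul]
    have hxE : x ∈ E := Module.End.mem_eigenspace_iff.2 (by rw [Matrix.toLin'_apply, hxe])
    have : Nontrivial E := ⟨⟨⟨x, hxE⟩, 0, fun h => hx (congrArg Subtype.val h)⟩⟩
    obtain ⟨z, hz⟩ := Module.End.exists_eigenvalue ((Matrix.toLin' U).restrict hmaps)
    obtain ⟨⟨y, hyE⟩, hy⟩ := hz.exists_hasEigenvector
    have hy0 : y ≠ 0 := fun h => hy.2 (Subtype.ext h)
    have hyU : U *ᵥ y = z • y := by
      have := congrArg Subtype.val hy.apply_eq_smul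
      simpa using this
    have hyH : H *ᵥ y = ((μ + 2 * c : ℝ) : ℂ) • y := by
      rwa [Module.End.mem_eigenspace_iff, Matrix.toLin'_apply] at hyE
    have h1 : expect y H = expect y U + star (expect y U) := by
      rw [← expect_conjTranspose, hH, expect, Matrix.add_mulVec, dotProduct_add]
      rfl
    have hs : star (star y ⬝ᵥ y) = star y ⬝ᵥ y := (Matrix.star_dotProduct _ _).symm
    have hs0 : star y ⬝ᵥ y ≠ 0 := fun h0 => hy0 (dotProduct_star_self_eq_zero.1 h0)
    rw [expect_of_mulVec_eq_smul hyH, expect_of_mulVec_eq_smul hyU, star_mul', hs, ← add_mul,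
      mul_left_inj' hs0, Complex.star_def, Complex.add_conj, Complex.ofReal_inj] at h1
    have h2 := cos_unitaryCost_le_re hU1 hy0 hyU
    simp only [Pi.zero_apply]
    linarith
  have h := hpsd.re_dotProduct_nonneg φ
  rw [Matrix.sub_mulVec, Matrix.smul_mulVec, Matrix.one_mulVec, dotProduct_sub, dotProduct_smul,
    hφ, hH, Matrix.add_mulVec, dotProduct_add] at h
  change 0 ≤ (expect φ U + expect φ Uᴴ - _).re at h
  rw [expect_conjTranspose] at h
  simp at h
  linarith

end UnitarySpectrum

/-! ### Kraus operators of an extension and the lower bound on its cost. -/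

section Extensions

variable {n : ℕ}

theorem trFst_conj_kronecker {m : ℕ} (U : Matrix (Fin (m + 1) × Fin n) (Fin (m + 1) × Fin n) ℂ)
    (ρ : Matrix (Fin n) (Fin n) ℂ) :
    trFst (U * (ketbra (Pi.single (0 : Fin (m + 1)) (1 : ℂ)) ⊗ₖ ρ) * Uᴴ) =
      krausMap (fun i => Matrix.of fun b b' => U (i, b) (0, b')) ρ := by
  ext b b'
  simp only [trFst, krausMap, LinearMap.coe_mk, AddHom.coe_mk, Matrix.of_apply, Matrix.sum_apply]
  refine Finset.sum_congr rfl fun i _ => ?_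
  simp [Matrix.mul_apply, Fintype.sum_prod_type, ketbra, Matrix.vecMulVec_apply, Pi.single_apply,
    Matrix.kroneckerMap_apply]

theorem vecMulVec_star_eq_sum_ketbra {ι : Type*} (x y : ι → ℂ) :
    Matrix.vecMulVec x (star y) = (1 / 4 : ℂ) • (ketbra (x + y) - ketbra (x - y)
      + Complex.I • ketbra (x + Complex.I • y) - Complex.I • ketbra (x - Complex.I • y)) := by
  ext a b
  simp [ketbra, Matrix.vecMulVec_apply]
  linear_combination ((1 / 2) * (x a * (starRingEnd ℂ) (y b)) - (1 / 2)
    * (y a * (starRingEnd ℂ) (x b))) * Complex.I_sq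

/-- Pure states span all matrices, by polarization. Hence an extension, constrained only on density
matrices, determines the whole channel. -/
theorem linearMap_ext_of_isDensity {V : Type*} [AddCommGroup V] [Module ℂ V]
    {Φ Φ' : Matrix (Fin n) (Fin n) ℂ →ₗ[ℂ] V} (h : ∀ ρ, IsDensity ρ → Φ ρ = Φ' ρ) :
    Φ = Φ' := by
  have h1 : ∀ φ : Fin n → ℂ, Φ (ketbra φ) = Φ' (ketbra φ) := by
    intro φ
    by_cases hφ : φ = 0
    · simp [hφ, ketbra]
    · obtain ⟨r, ψ, -, hψ, rfl⟩ := exists_isState_smul hφ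
      have : ketbra ((r : ℂ) • ψ) = ((r : ℂ) * star (r : ℂ)) • ketbra ψ := by
        ext a b
        simp [ketbra, Matrix.vecMulVec_apply]
        ring
      rw [this, map_smul, map_smul, h _ (isDensity_ketbra hψ)]
  refine Matrix.ext_linearMap ℂ fun i j => ?_
  ext
  have h2 : Matrix.single i j (1 : ℂ) =
      Matrix.vecMulVec (Pi.single i 1) (star (Pi.single j 1 : Fin n → ℂ)) := by
    ext a b
    simp only [Matrix.single_apply, Matrix.vecMulVec_apply, Pi.single_apply, Pi.star_apply]
    split_ifs <;> simp_all
  change Φ (Matrix.single i j 1) = Φ' (Matrix.single i j 1)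
  rw [h2, vecMulVec_star_eq_sum_ketbra]
  simp only [map_smul, map_add, map_sub, h1]

theorem cos_unitaryCost_le_norm_overlap {d m : ℕ} {K : Fin d → Matrix (Fin n) (Fin n) ℂ}
    {U : Matrix (Fin (m + 1) × Fin n) (Fin (m + 1) × Fin n) ℂ}
    (hU : IsUnitaryExtension (krausMap K) U) {ρ : Matrix (Fin n) (Fin n) ℂ} (hρ : IsDensity ρ) :
    Real.cos (unitaryCost U) ≤ ‖overlap K ρ‖ := by
  set L : Fin (m + 1) → Matrix (Fin n) (Fin n) ℂ := fun i => Matrix.of fun b b' => U (i, b) (0, b')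
  have hKL : krausMap K = krausMap L := linearMap_ext_of_isDensity fun σ hσ => by
    rw [hU.2 σ hσ, trFst_conj_kronecker]
  obtain ⟨Ψ, hΨ, rfl⟩ := hρ.exists_purification
  -- The fidelity depends only on the channel, so the overlap norm is the same for the Kraus
  -- families `K` and `L`.
  rw [← inOutFidelity_krausMap K hΨ, hKL, inOutFidelity_krausMap L hΨ]
  set c := Real.cos (unitaryCost U)
  have h0 : ((trFst (ketbra Ψ)) * (L 0 - (c : ℂ) • 1)).trace.re ≥ 0 := by
    rw [Matrix.trace_mul_comm, trFst_ketbra, Finset.mul_sum, Matrix.trace_sum, Complex.re_sum]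
    refine Finset.sum_nonneg fun a _ => ?_
    rw [trace_mul_ketbra]
    by_cases hφ : (fun b => Ψ (a, b)) = 0
    · simp [hφ, expect]
    · obtain ⟨r, ψ, -, hψ, h⟩ := exists_isState_smul hφ
      rw [h, expect_ofReal_smul, Complex.re_ofReal_mul]
      refine mul_nonneg (sq_nonneg r) ?_
      -- `L 0` is the compression of `U` to `|0⟩ ⊗ B`; the test vector is `|0⟩ ⊗ ψ`.
      have h1 := cos_unitaryCost_le_re_expect hU.1
        (φ := fun p => (Pi.single 0 1 : Fin (m + 1) → ℂ) p.1 * ψ p.2) (by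
          simpa [IsState, dotProduct, Fintype.sum_prod_type, Pi.single_apply] using hψ)
      have h2 : expect (fun p => (Pi.single 0 1 : Fin (m + 1) → ℂ) p.1 * ψ p.2) U =
          expect ψ (L 0) := by
        simp only [expect, dotProduct, Matrix.mulVec, Fintype.sum_prod_type, L, Pi.star_apply,
          Matrix.of_apply]
        rw [Fintype.sum_eq_single 0 fun i hi => by simp [hi]]
        refine Finset.sum_congr rfl fun b _ => ?_
        rw [Finset.sum_comm]
        simp [Pi.single_apply]
      rw [h2] at h1
      rw [expect, Matrix.sub_mulVec, dotProduct_sub, Matrix.smul_mulVec, Matrix.one_mulVec,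
        dotProduct_smul, hψ]
      change 0 ≤ (expect ψ (L 0) - _).re
      simpa using h1
  rw [mul_sub, Matrix.mul_smul, mul_one, Matrix.trace_sub, Matrix.trace_smul,
    (isDensity_trFst_ketbra hΨ).2, Complex.sub_re] at h0
  calc c ≤ (trFst (ketbra Ψ) * L 0).trace.re := by simpa using h0
    _ ≤ ‖(trFst (ketbra Ψ) * L 0).trace‖ := Complex.re_le_norm _
    _ = ‖overlap L (trFst (ketbra Ψ)) 0‖ := rfl
    _ ≤ ‖overlap L (trFst (ketbra Ψ))‖ := PiLp.norm_apply_le _ _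

end Extensions

/-! ### Krein extension, Cayley transform, and unitaries joining two isometries. -/

section Dilation

variable {ι κ : Type*} [Fintype ι] [DecidableEq ι] [Fintype κ] [DecidableEq κ]

theorem _root_.Matrix.IsHermitian.exists_hermitian_generalizedInverse {W : Matrix κ κ ℂ}
    (hW : W.IsHermitian) : ∃ X : Matrix κ κ ℂ, X.IsHermitian ∧ W * X * W = W := by
  set Q : Matrix κ κ ℂ := ↑hW.eigenvectorUnitary with hQdef
  have hQ : Qᴴ * Q = 1 := Matrix.mem_unitaryGroup_iff'.1 hW.eigenvectorUnitary.2
  set Λ : Matrix κ κ ℂ := Matrix.diagonal fun i => (hW.eigenvalues i : ℂ) with hΛ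
  -- Since `0⁻¹ = 0`, this inverts the nonzero eigenvalues and kills the rest.
  set Ξ : Matrix κ κ ℂ := Matrix.diagonal fun i => ((hW.eigenvalues i)⁻¹ : ℂ) with hΞ
  have hWQ : W = Q * Λ * Qᴴ := by
    have := hW.spectral_theorem
    rw [Unitary.conjStarAlgAut_apply] at this
    exact this
  have hΛΞ : Λ * Ξ * Λ = Λ := by
    rw [hΛ, hΞ, Matrix.diagonal_mul_diagonal, Matrix.diagonal_mul_diagonal]
    congr 1
    funext i
    exact mul_inv_mul_cancel _
  refine ⟨Q * Ξ * Qᴴ, ?_, ?_⟩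
  · refine Matrix.isHermitian_mul_mul_conjTranspose Q ?_
    refine Matrix.isHermitian_diagonal_of_self_adjoint _ ?_
    ext i
    simp
  · calc W * (Q * Ξ * Qᴴ) * W
        = Q * Λ * (Qᴴ * Q) * Ξ * (Qᴴ * Q) * Λ * Qᴴ := by
          conv_lhs => rw [hWQ]
          simp only [mul_assoc]
      _ = Q * (Λ * Ξ * Λ) * Qᴴ := by simp only [hQ, mul_one, mul_assoc]
      _ = W := by rw [hΛΞ, ← hWQ]

/-- **Krein's extension theorem** for symmetric contractions, in finite dimension. -/
theorem exists_hermitian_extension {S D : Matrix ι κ ℂ} {τ : ℝ} (hsym : (Sᴴ * D).IsHermitian)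
    (hle : (((τ ^ 2 : ℝ) : ℂ) • (Sᴴ * S) - Dᴴ * D).PosSemidef) :
    ∃ T : Matrix ι ι ℂ, T.IsHermitian ∧ T * S = D ∧
      (((τ ^ 2 : ℝ) : ℂ) • (1 : Matrix ι ι ℂ) - T * T).PosSemidef := by
  have hsym' : Dᴴ * S = Sᴴ * D := by
    have := hsym.eq
    rwa [Matrix.conjTranspose_mul, Matrix.conjTranspose_conjTranspose] at this
  -- Shifting by `τ`, the goal is `P = T + τ` with `P S = Y` and `P² ≤ 2τ P`. The choice is `P = Y X
  -- Yᴴ`, with `X` a generalized inverse of `W = Sᴴ Y`.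
  set Y : Matrix ι κ ℂ := (τ : ℂ) • S + D with hY
  have hYt : Yᴴ = (τ : ℂ) • Sᴴ + Dᴴ := by
    rw [hY, Matrix.conjTranspose_add, Matrix.conjTranspose_smul]
    simp
  set W : Matrix κ κ ℂ := Sᴴ * Y with hW
  have hYS : Yᴴ * S = W := by
    rw [hYt, hW, hY, Matrix.add_mul, Matrix.mul_add, hsym', Matrix.smul_mul, Matrix.mul_smul]
  have hWH : W.IsHermitian := by
    rw [Matrix.IsHermitian, hW, Matrix.conjTranspose_mul, Matrix.conjTranspose_conjTranspose, hYS]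
  have hYY : ((2 * τ : ℂ) • W - Yᴴ * Y).PosSemidef := by
    have : (2 * τ : ℂ) • W - Yᴴ * Y = ((τ ^ 2 : ℝ) : ℂ) • (Sᴴ * S) - Dᴴ * D := by
      rw [hW, hYt, hY]
      simp only [Matrix.add_mul, Matrix.mul_add, Matrix.smul_mul, Matrix.mul_smul, hsym']
      push_cast
      module
    rwa [this]
  obtain ⟨X, hX, hWXW⟩ := hWH.exists_hermitian_generalizedInverse
  -- `Yᴴ Y ≤ 2τ W` forces `Y` to vanish on the kernel of `W`, which contains the range of `X W - 1`.
  have hYXW : Y * X * W = Y := by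
    set Z : Matrix κ κ ℂ := X * W - 1 with hZ
    have hWZ : W * Z = 0 := by rw [hZ, mul_sub, ← mul_assoc, hWXW, mul_one, sub_self]
    have h1 := hYY.conjTranspose_mul_mul_same Z
    have h2 : Zᴴ * ((2 * τ : ℂ) • W - Yᴴ * Y) * Z = -((Y * Z)ᴴ * (Y * Z)) := by
      rw [mul_assoc, Matrix.sub_mul, Matrix.smul_mul, hWZ, Matrix.conjTranspose_mul]
      simp [Matrix.mul_assoc]
    rw [h2] at h1
    have h3 : (Y * Z)ᴴ * (Y * Z) = 0 :=
      le_antisymm (neg_nonneg.1 (Matrix.nonneg_iff_posSemidef.2 h1))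
        (Matrix.nonneg_iff_posSemidef.2 (Matrix.posSemidef_conjTranspose_mul_self _))
    rw [Matrix.conjTranspose_mul_self_eq_zero, hZ, Matrix.mul_sub, Matrix.mul_one,
      ← Matrix.mul_assoc] at h3
    exact sub_eq_zero.1 h3
  have hP : (Y * X * Yᴴ).IsHermitian := Matrix.isHermitian_mul_mul_conjTranspose Y hX
  refine ⟨Y * X * Yᴴ - (τ : ℂ) • 1, ?_, ?_, ?_⟩
  · refine hP.sub ?_
    rw [Matrix.IsHermitian, Matrix.conjTranspose_smul]
    simp
  · rw [Matrix.sub_mul, Matrix.mul_assoc, hYS, hYXW, Matrix.smul_mul, Matrix.one_mul, hY,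
      add_sub_cancel_left]
  -- `τ² - T² = 2τ P - P²` is the conjugate of `2τ W - Yᴴ Y` by `Y X`.
  · have h := hYY.mul_mul_conjTranspose_same (Y * X)
    have h4 : Y * X * W * (X * Yᴴ) = Y * X * Yᴴ := by rw [hYXW, Matrix.mul_assoc]
    have h5 : Y * X * (Yᴴ * Y) * (X * Yᴴ) = Y * X * Yᴴ * (Y * X * Yᴴ) := by
      simp only [Matrix.mul_assoc]
    rw [Matrix.conjTranspose_mul, hX.eq, Matrix.mul_sub, Matrix.sub_mul, Matrix.mul_smul,
      Matrix.smul_mul, h4, h5] at h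
    convert h using 1
    simp only [sub_mul, mul_sub, smul_mul_assoc, mul_smul_comm, one_mul, mul_one]
    push_cast
    module

/-- The Cayley transform of a Hermitian matrix. -/
theorem exists_cayley {T : Matrix ι ι ℂ} (hT : T.IsHermitian) :
    IsUnit (1 + Complex.I • T) ∧
      ∃ U ∈ Matrix.unitaryGroup ι ℂ, U * (1 + Complex.I • T) = 1 - Complex.I • T := by
  set A : Matrix ι ι ℂ := 1 + Complex.I • T with hA
  have hAt : Aᴴ = 1 - Complex.I • T := by
    rw [hA, Matrix.conjTranspose_add, Matrix.conjTranspose_smul, hT.eq]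
    simp [sub_eq_add_neg]
  have hAA : Aᴴ * A = 1 + Tᴴ * T := by
    rw [hAt, hA, hT.eq]
    simp only [sub_mul, mul_add, smul_mul_assoc, mul_smul_comm, one_mul, mul_one]
    match_scalars <;> simp
  have hAA' : A * Aᴴ = Aᴴ * A := by
    rw [hAA, hAt, hA, hT.eq]
    simp only [add_mul, mul_sub, smul_mul_assoc, mul_smul_comm, one_mul, mul_one]
    match_scalars <;> simp
  have hu : IsUnit (Aᴴ * A) := by
    rw [hAA]
    exact (Matrix.PosDef.one.add_posSemidef (Matrix.posSemidef_conjTranspose_mul_self T)).isUnit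
  have huA : IsUnit A := by
    rw [Matrix.isUnit_iff_isUnit_det, Matrix.det_mul] at hu
    exact (Matrix.isUnit_iff_isUnit_det A).2 (isUnit_of_mul_isUnit_right hu)
  have hdet := (Matrix.isUnit_iff_isUnit_det A).1 huA
  refine ⟨huA, Aᴴ * A⁻¹, ?_, ?_⟩
  · rw [Matrix.mem_unitaryGroup_iff']
    calc (Aᴴ * A⁻¹)ᴴ * (Aᴴ * A⁻¹) = (A⁻¹)ᴴ * (A * Aᴴ) * A⁻¹ := by
          rw [Matrix.conjTranspose_mul, Matrix.conjTranspose_conjTranspose]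
          simp only [mul_assoc]
      _ = (A * A⁻¹)ᴴ * (A * A⁻¹) := by
          rw [hAA', Matrix.conjTranspose_mul]
          simp only [mul_assoc]
      _ = 1 := by rw [Matrix.mul_nonsing_inv _ hdet]; simp
  · rw [mul_assoc, Matrix.nonsing_inv_mul _ hdet, mul_one, hAt]

/-- For `v = (1 + iT) y` the eigenvalue equation reads `(1 - z) y = i (1 + z) T y`. Taking norms
with `‖T y‖ ≤ τ ‖y‖` gives `1 - Re z ≤ τ² (1 + Re z)`, that is `Re z ≥ c`. -/
theorem le_re_of_cayley {T U : Matrix ι ι ℂ} {τ c : ℝ} (hT : T.IsHermitian)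
    (hu : IsUnit (1 + Complex.I • T)) (hU : U * (1 + Complex.I • T) = 1 - Complex.I • T)
    (hle : (((τ ^ 2 : ℝ) : ℂ) • (1 : Matrix ι ι ℂ) - T * T).PosSemidef)
    (hτ : τ ^ 2 * (1 + c) = 1 - c) (hc : 0 < 1 + c)
    {z : ℂ} {v : ι → ℂ} (hz : ‖z‖ = 1) (hv : v ≠ 0) (h : U *ᵥ v = z • v) : c ≤ z.re := by
  have hdet := (Matrix.isUnit_iff_isUnit_det _).1 hu
  set A : Matrix ι ι ℂ := 1 + Complex.I • T with hA
  obtain ⟨y, hy⟩ : ∃ y, v = A *ᵥ y :=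
    ⟨A⁻¹ *ᵥ v, by rw [Matrix.mulVec_mulVec, Matrix.mul_nonsing_inv _ hdet, Matrix.one_mulVec]⟩
  have hy0 : y ≠ 0 := by
    rintro rfl
    exact hv (by rw [hy, Matrix.mulVec_zero])
  have h1 : y - Complex.I • (T *ᵥ y) = z • (y + Complex.I • (T *ᵥ y)) := by
    rw [hy, Matrix.mulVec_mulVec, hU, hA, Matrix.sub_mulVec, Matrix.add_mulVec,
      Matrix.smul_mulVec, Matrix.one_mulVec] at h
    exact h
  have h2 : (1 - z) • y = (Complex.I * (1 + z)) • (T *ᵥ y) := by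
    have : (1 - z) • y = y - Complex.I • (T *ᵥ y) + Complex.I • (T *ᵥ y) - z • y := by module
    rw [this, h1]
    module
  have nsq : ∀ (a : ℂ) (x : ι → ℂ), star (a • x) ⬝ᵥ (a • x) =
      ((‖a‖ ^ 2 : ℝ) : ℂ) * (star x ⬝ᵥ x) := by
    intro a x
    rw [star_smul, smul_dotProduct, dotProduct_smul, smul_smul, smul_eq_mul, Complex.star_def,
      Complex.conj_mul']
    push_cast
    rfl
  have h3 := congrArg (fun x => (star x ⬝ᵥ x).re) h2
  simp only [nsq, Complex.re_ofReal_mul] at h3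
  have h4 := hle.re_dotProduct_nonneg y
  have h5 : star y ⬝ᵥ ((T * T) *ᵥ y) = star (T *ᵥ y) ⬝ᵥ (T *ᵥ y) := by
    rw [Matrix.star_mulVec, ← Matrix.dotProduct_mulVec, Matrix.mulVec_mulVec, hT.eq]
  rw [Matrix.sub_mulVec, Matrix.smul_mulVec, Matrix.one_mulVec, dotProduct_sub, dotProduct_smul,
    h5, smul_eq_mul, RCLike.re_eq_complex_re, Complex.sub_re, Complex.re_ofReal_mul] at h4
  have hs : 0 < (star y ⬝ᵥ y).re := (Complex.pos_iff.1 (Matrix.dotProduct_star_self_pos_iff.2 hy0)).1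
  have hz2 : z.re * z.re + z.im * z.im = 1 := by
    rw [← Complex.normSq_apply, Complex.normSq_eq_norm_sq, hz, one_pow]
  have n1 : ‖1 - z‖ ^ 2 = 2 - 2 * z.re := by
    rw [← Complex.normSq_eq_norm_sq, Complex.normSq_apply]
    simp
    linarith
  have n2 : ‖Complex.I * (1 + z)‖ ^ 2 = 2 + 2 * z.re := by
    rw [norm_mul, Complex.norm_I, one_mul, ← Complex.normSq_eq_norm_sq, Complex.normSq_apply]
    simp
    linarith
  rw [n1, n2] at h3
  have hz1 : -1 ≤ z.re := (abs_le.1 ((Complex.abs_re_le_norm z).trans hz.le)).1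
  set s := (star y ⬝ᵥ y).re
  set t := (star (T *ᵥ y) ⬝ᵥ (T *ᵥ y)).re
  have h6 : (2 - 2 * z.re) * s ≤ (2 + 2 * z.re) * (τ ^ 2 * s) := by
    rw [h3]
    exact mul_le_mul_of_nonneg_left (by linarith) (by linarith)
  have h7 : 2 - 2 * z.re ≤ (2 + 2 * z.re) * τ ^ 2 :=
    le_of_mul_le_mul_right (by linarith) hs
  have h8 := mul_le_mul_of_nonneg_right h7 hc.le
  rw [mul_assoc, hτ] at h8
  linarith

/-- Two isometries `J`, `V` with `Re (Jᴴ V) ≥ c` are related by a unitary matrix whose spectrum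
has real part at least `c`. -/
theorem exists_unitary_mul_eq [Nonempty κ] {J V : Matrix ι κ ℂ} {c : ℝ} (hJ : Jᴴ * J = 1)
    (hV : Vᴴ * V = 1) (hc : 0 < 1 + c)
    (hle : (Jᴴ * V + Vᴴ * J - ((2 * c : ℝ) : ℂ) • (1 : Matrix κ κ ℂ)).PosSemidef) :
    c ≤ 1 ∧ ∃ U ∈ Matrix.unitaryGroup ι ℂ, U * J = V ∧ unitaryCost U ≤ Real.arccos c := by
  have hDD : (J - V)ᴴ * (J - V) = (2 : ℂ) • (1 : Matrix κ κ ℂ) - (Jᴴ * V + Vᴴ * J) := by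
    rw [Matrix.conjTranspose_sub, Matrix.sub_mul, Matrix.mul_sub, Matrix.mul_sub, hJ, hV]
    module
  have hSS : (J + V)ᴴ * (J + V) = (2 : ℂ) • (1 : Matrix κ κ ℂ) + (Jᴴ * V + Vᴴ * J) := by
    rw [Matrix.conjTranspose_add, Matrix.add_mul, Matrix.mul_add, Matrix.mul_add, hJ, hV]
    module
  -- Adding `(J - V)ᴴ (J - V) ≥ 0` to the hypothesis leaves `(2 - 2c) • 1 ≥ 0`, read off at a
  -- diagonal entry.
  have hc1 : c ≤ 1 := by
    have h := hle.add (Matrix.posSemidef_conjTranspose_mul_self (J - V))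
    rw [hDD] at h
    have h1 := (Complex.nonneg_iff.1 (h.diag_nonneg (i := Classical.arbitrary κ))).1
    simp at h1
    linarith
  refine ⟨hc1, ?_⟩
  -- This is `tan(½ arccos c)`, the bound on `T` matching `Re z ≥ c` under the Cayley transform.
  set τ : ℝ := √((1 - c) / (1 + c)) with hτdef
  have hτ2 : τ ^ 2 = (1 - c) / (1 + c) := Real.sq_sqrt (div_nonneg (by linarith) hc.le)
  have hτ : τ ^ 2 * (1 + c) = 1 - c := by rw [hτ2, div_mul_cancel₀ _ hc.ne']
  -- Solving `(1 + iT) V = (1 - iT) J` for `T` gives `T (J + V) = -i (J - V)`.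
  obtain ⟨T, hT, hTS, hT2⟩ := exists_hermitian_extension (S := J + V)
    (D := -(Complex.I • (J - V))) (τ := τ) (by
      rw [Matrix.IsHermitian, Matrix.mul_neg, Matrix.mul_smul, Matrix.conjTranspose_neg,
        Matrix.conjTranspose_smul, Matrix.conjTranspose_mul, Matrix.conjTranspose_conjTranspose,
        Matrix.conjTranspose_sub, Matrix.conjTranspose_add]
      simp only [Matrix.sub_mul, Matrix.mul_add, Matrix.add_mul, Matrix.mul_sub, hJ, hV,
        Complex.star_def, Complex.conj_I]
      module) (by
      have h : ((τ ^ 2 : ℝ) : ℂ) • ((J + V)ᴴ * (J + V)) -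
          (-(Complex.I • (J - V)))ᴴ * (-(Complex.I • (J - V))) =
          ((2 / (1 + c) : ℝ) : ℂ) •
            (Jᴴ * V + Vᴴ * J - ((2 * c : ℝ) : ℂ) • (1 : Matrix κ κ ℂ)) := by
        rw [Matrix.conjTranspose_neg, Matrix.neg_mul, Matrix.mul_neg, neg_neg, Matrix.conjTranspose_smul,
          Matrix.smul_mul, Matrix.mul_smul, smul_smul, hSS, hDD, hτ2]
        have hI : star Complex.I * Complex.I = 1 := by simp
        have hc' : (1 + c : ℂ) ≠ 0 := by exact_mod_cast hc.ne'
        rw [hI, one_smul]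
        push_cast
        match_scalars <;> field_simp <;> ring
      rw [h]
      exact hle.smul (by exact_mod_cast (div_pos two_pos hc).le))
  obtain ⟨hu, U, hU, hUA⟩ := exists_cayley hT
  refine ⟨U, hU, ?_, unitaryCost_le_arccos fun z v hz hv h =>
    le_re_of_cayley hT hu hUA hT2 hτ hc hz hv h⟩
  have hdet := (Matrix.isUnit_iff_isUnit_det _).1 hu
  have hTJ : (1 + Complex.I • T) * V = (1 - Complex.I • T) * J := by
    have h1 : Complex.I • (T * (J + V)) = J - V := by
      rw [hTS, smul_neg, smul_smul, Complex.I_mul_I, neg_smul, one_smul, neg_neg]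
    rw [Matrix.mul_add, smul_add] at h1
    rw [Matrix.add_mul, Matrix.sub_mul, Matrix.one_mul, Matrix.one_mul, Matrix.smul_mul,
      Matrix.smul_mul, eq_sub_iff_add_eq, add_assoc, add_comm (Complex.I • (T * V)), h1]
    abel
  have hcomm : (1 + Complex.I • T) * U = U * (1 + Complex.I • T) := by
    have h2 : (1 + Complex.I • T) * (1 - Complex.I • T) =
        (1 - Complex.I • T) * (1 + Complex.I • T) := by
      simp only [add_mul, mul_sub, sub_mul, mul_add, one_mul, mul_one]
      abel
    refine hu.mul_right_cancel ?_
    rw [mul_assoc, hUA, h2]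
  have h4 : (1 + Complex.I • T) * (U * J) = (1 + Complex.I • T) * V := by
    rw [← Matrix.mul_assoc, hcomm, hUA, hTJ]
  have h5 := congrArg ((1 + Complex.I • T)⁻¹ * ·) h4
  simpa only [← Matrix.mul_assoc, Matrix.nonsing_inv_mul _ hdet, Matrix.one_mul] using h5

end Dilation

/-! ### Unitary mixing of Kraus operators. -/

section KrausFreedom

variable {d n : ℕ}

/-- Serves both to keep `∑ (K_j)ᴴ K_j` and to keep the channel when the Kraus family is mixed by a
unitary. -/
theorem sum_mul_sum_of_orthonormal {κ : Type*} [Fintype κ] [DecidableEq κ] {R : Type*} [Ring R]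
    [Algebra ℂ R] {a b : κ → κ → ℂ} (h : ∀ j k, ∑ i, a i j * b i k = if j = k then 1 else 0)
    (A B : κ → R) :
    ∑ i, (∑ j, a i j • A j) * (∑ k, b i k • B k) = ∑ j, A j * B j := by
  calc ∑ i, (∑ j, a i j • A j) * (∑ k, b i k • B k)
      = ∑ i, ∑ j, ∑ k, (a i j * b i k) • (A j * B k) := by
        simp only [Finset.sum_mul_sum, smul_mul_smul_comm]
    _ = ∑ j, ∑ k, (∑ i, a i j * b i k) • (A j * B k) := by
        rw [Finset.sum_comm]
        refine Finset.sum_congr rfl fun j _ => ?_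
        rw [Finset.sum_comm]
        simp only [Finset.sum_smul]
    _ = ∑ j, A j * B j := by simp [h]

theorem exists_unitary_row_zero {m : ℕ} {w : Fin (m + 1) → ℂ} (hw : IsState w) :
    ∃ u ∈ Matrix.unitaryGroup (Fin (m + 1)) ℂ, u 0 = w := by
  have hnorm : ‖(WithLp.toLp 2 w : EuclideanSpace ℂ (Fin (m + 1)))‖ = 1 := by
    have h1 : star w ⬝ᵥ w = ((‖WithLp.toLp 2 w‖ ^ 2 : ℝ) : ℂ) := by
      rw [EuclideanSpace.norm_sq_eq]
      simp [dotProduct, Complex.conj_mul']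
    rw [hw] at h1
    exact (pow_eq_one_iff_of_nonneg (norm_nonneg _) two_ne_zero).1 (by exact_mod_cast h1.symm)
  obtain ⟨b, hb⟩ := Orthonormal.exists_orthonormalBasis_extension_of_card_eq (𝕜 := ℂ)
    (E := EuclideanSpace ℂ (Fin (m + 1))) (ι := Fin (m + 1)) (by simp)
    (v := fun _ => WithLp.toLp 2 w) (s := {0}) (by
      constructor
      · intro i
        exact hnorm
      · intro i j hij
        exact absurd (Subsingleton.elim i j) hij)
  refine ⟨Matrix.of fun i j => b i j, ?_, ?_⟩
  · rw [Matrix.mem_unitaryGroup_iff]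
    ext i j
    have h := orthonormal_iff_ite.1 b.orthonormal j i
    rw [PiLp.inner_apply] at h
    simp only [Matrix.mul_apply, Matrix.star_apply, Matrix.of_apply, Matrix.one_apply]
    simp only [RCLike.inner_apply] at h
    simpa only [eq_comm (a := j), Complex.star_def] using h
  · funext j
    simp [hb 0 rfl]

end KrausFreedom

/-! ### An extension of optimal cost, and the main theorem. -/

theorem isState_optWeight {d n : ℕ} {K : Fin d → Matrix (Fin n) (Fin n) ℂ}
    {ρ : Matrix (Fin n) (Fin n) ℂ} (h : 0 < ‖overlap K ρ‖) : IsState (optWeight ρ K) := by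
  have h1 : (‖overlap K ρ‖ : ℂ) ≠ 0 := by exact_mod_cast h.ne'
  have h2 : (‖overlap K ρ‖ : ℂ) ^ 2 = ∑ j, ((‖(ρ * K j).trace‖ : ℂ) ^ 2) := by
    have := EuclideanSpace.norm_sq_eq (overlap K ρ)
    simp only [overlap_apply] at this
    exact_mod_cast this
  rw [IsState, dotProduct]
  have h3 : ∀ i, (star (optWeight ρ K)) i * optWeight ρ K i =
      (‖(ρ * K i).trace‖ : ℂ) ^ 2 / (‖overlap K ρ‖ : ℂ) ^ 2 := by
    intro i
    rw [Pi.star_apply, optWeight, ← norm_overlap, Complex.star_def, map_div₀,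
      Complex.conj_conj, Complex.conj_ofReal, div_mul_div_comm,
      Complex.mul_conj', ← sq]
  simp only [h3]
  rw [← Finset.sum_div, ← h2, div_self (pow_ne_zero 2 h1)]

theorem exists_unitaryExtension {m n : ℕ} [NeZero n]
    {K : Fin (m + 1) → Matrix (Fin n) (Fin n) ℂ} (hK : ∑ j, (K j)ᴴ * K j = 1)
    {ρ : Matrix (Fin n) (Fin n) ℂ} (hρ : IsDensity ρ) (hpos : 0 < ‖overlap K ρ‖)
    (hmin : ∀ τ, IsDensity τ → ‖overlap K ρ‖ ≤ ‖overlap K τ‖) :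
    ‖overlap K ρ‖ ≤ 1 ∧ ∃ U : Matrix (Fin (m + 1) × Fin n) (Fin (m + 1) × Fin n) ℂ,
      IsUnitaryExtension (krausMap K) U ∧ unitaryCost U ≤ Real.arccos ‖overlap K ρ‖ := by
  -- The row `u 0` is the optimal weight vector, so the mixed operator `L 0` has `Re ⟨ψ|L 0|ψ⟩` at
  -- least the minimal fidelity.
  obtain ⟨u, hu, hu0⟩ := exists_unitary_row_zero (isState_optWeight hpos)
  have huu : ∀ j k, ∑ i, star (u i j) * u i k = if j = k then 1 else 0 := by
    intro j k
    have := congrFun (congrFun (Matrix.mem_unitaryGroup_iff'.1 hu) j) k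
    simpa only [Matrix.mul_apply, Matrix.star_apply, Matrix.one_apply] using this
  set L : Fin (m + 1) → Matrix (Fin n) (Fin n) ℂ := fun i => ∑ j, u i j • K j with hL
  have hLt : ∀ i, (L i)ᴴ = ∑ j, star (u i j) • (K j)ᴴ := by
    intro i
    simp only [hL, Matrix.conjTranspose_sum, Matrix.conjTranspose_smul]
  have hL1 : ∑ i, (L i)ᴴ * L i = 1 := by
    simp only [hLt]
    rw [← hK]
    exact sum_mul_sum_of_orthonormal huu _ _
  have hLK : krausMap L = krausMap K := by
    refine LinearMap.ext fun σ => ?_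
    change ∑ i, L i * σ * (L i)ᴴ = ∑ i, K i * σ * (K i)ᴴ
    simp only [hLt]
    have hLσ : ∀ i, L i * σ = ∑ j, u i j • (K j * σ) := fun i => by
      simp only [hL, Finset.sum_mul, smul_mul_assoc]
    simp only [hLσ]
    refine sum_mul_sum_of_orthonormal (fun j k => ?_) (fun j => K j * σ) _
    simp only [mul_comm (u _ _), huu, eq_comm (a := k)]
  -- `V` stacks the `L i` into the Stinespring isometry and `J` sends `φ` to `|0⟩ ⊗ φ`. Any unitary
  -- with `U J = V` then extends the channel.
  set V : Matrix (Fin (m + 1) × Fin n) (Fin n) ℂ := Matrix.of fun p b => L p.1 p.2 b with hVdef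
  set J : Matrix (Fin (m + 1) × Fin n) (Fin n) ℂ :=
    Matrix.of fun p b => if p = (0, b) then 1 else 0 with hJdef
  have hV : Vᴴ * V = 1 := by
    rw [← hL1]
    ext a b
    simp [Matrix.mul_apply, Fintype.sum_prod_type, V, Matrix.sum_apply]
  have hMJ : ∀ {α : Type} (B : Matrix α (Fin (m + 1) × Fin n) ℂ) (a : α) (b : Fin n),
      (B * J) a b = B a (0, b) := by
    intro α B a b
    simp [Matrix.mul_apply, J]
  have hJ : Jᴴ * J = 1 := by
    ext a b
    rw [hMJ, Matrix.conjTranspose_apply]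
    simp [J, Matrix.one_apply, eq_comm]
  have hVJ : Vᴴ * J = (L 0)ᴴ := by
    ext a b
    rw [hMJ, Matrix.conjTranspose_apply, Matrix.conjTranspose_apply]
    rfl
  have hJV : Jᴴ * V = L 0 := by
    rw [← Matrix.conjTranspose_conjTranspose (Jᴴ * V), Matrix.conjTranspose_mul,
      Matrix.conjTranspose_conjTranspose, hVJ, Matrix.conjTranspose_conjTranspose]
  have hL0 : L 0 = ∑ i, optWeight ρ K i • K i := by simp only [hL, hu0]
  have hherm : (L 0 + (L 0)ᴴ -
      ((2 * ‖overlap K ρ‖ : ℝ) : ℂ) • (1 : Matrix (Fin n) (Fin n) ℂ)).IsHermitian := by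
    rw [Matrix.IsHermitian, Matrix.conjTranspose_sub, Matrix.conjTranspose_add,
      Matrix.conjTranspose_conjTranspose, add_comm, Matrix.conjTranspose_smul]
    simp
  obtain ⟨h1, U, hU, hUJ, hcost⟩ := exists_unitary_mul_eq hJ hV
    (c := ‖overlap K ρ‖) (by linarith) (by
      rw [hJV, hVJ]
      refine Matrix.PosSemidef.of_dotProduct_mulVec_nonneg hherm fun φ => ?_
      by_cases hφ : φ = 0
      · simp [hφ]
      obtain ⟨r, ψ, -, hψ, rfl⟩ := exists_isState_smul hφ
      change 0 ≤ expect _ _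
      rw [expect_ofReal_smul]
      refine mul_nonneg (by exact_mod_cast sq_nonneg r) ?_
      have h2 := norm_overlap_le_re_trace hρ (isDensity_ketbra hψ) hpos hmin
      rw [← hL0, Matrix.trace_mul_comm, trace_mul_ketbra] at h2
      rw [expect, Matrix.sub_mulVec, Matrix.add_mulVec, Matrix.smul_mulVec, Matrix.one_mulVec,
        dotProduct_sub, dotProduct_add, dotProduct_smul, hψ]
      change 0 ≤ expect ψ (L 0) + expect ψ (L 0)ᴴ - _
      rw [expect_conjTranspose, Complex.star_def, Complex.add_conj, smul_eq_mul, mul_one,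
        ← Complex.ofReal_sub]
      exact_mod_cast (by linarith : 0 ≤ 2 * (expect ψ (L 0)).re - 2 * ‖overlap K ρ‖))
  refine ⟨h1, U, ⟨hU, fun σ _ => ?_⟩, hcost⟩
  rw [trFst_conj_kronecker, ← hLK]
  congr 2
  funext i
  ext b b'
  rw [Matrix.of_apply, ← hMJ U, hUJ]
  rfl

end TimeEnergy

theorem theorem4 (d n : ℕ) (K : Fin d → Matrix (Fin n) (Fin n) ℂ)
    (hK : ∑ j, (K j)ᴴ * K j = 1)
    (hF : 0 < TimeEnergy.Fmin (TimeEnergy.krausMap K)) :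
    -- both minima are attained
    IsLeast (TimeEnergy.fidelities (TimeEnergy.krausMap K))
        (TimeEnergy.Fmin (TimeEnergy.krausMap K)) ∧
    IsLeast (TimeEnergy.extensionCosts (TimeEnergy.krausMap K))
        (TimeEnergy.channelCost (TimeEnergy.krausMap K)) ∧
    -- the equality
    TimeEnergy.Fmin (TimeEnergy.krausMap K) =
        Real.cos (TimeEnergy.channelCost (TimeEnergy.krausMap K)) ∧
    -- the formula at every optimal input, with reduced state `trFst (ketbra Ψ)` on `B`
    ∀ (k : ℕ) (Ψ : Fin k × Fin n → ℂ), TimeEnergy.IsState Ψ →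
      TimeEnergy.inOutFidelity (TimeEnergy.krausMap K) Ψ =
        TimeEnergy.Fmin (TimeEnergy.krausMap K) →
      IsLeast
        {t : ℝ | ∃ ψ : Fin n → ℂ, TimeEnergy.IsState ψ ∧
          t = (TimeEnergy.expect ψ
            (∑ i, TimeEnergy.optWeight (TimeEnergy.trFst (TimeEnergy.ketbra Ψ)) K i • K i)).re}
        (TimeEnergy.Fmin (TimeEnergy.krausMap K)) := by
  open TimeEnergy in
  -- The infimum of the empty set is `0` by convention, so positivity supplies an input state.
  have hne : (fidelities (krausMap K)).Nonempty := by
    by_contra h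
    rw [Set.not_nonempty_iff_eq_empty] at h
    rw [Fmin, h, Real.sInf_empty] at hF
    exact hF.false
  have hleast := isLeast_Fmin_of_nonempty K hne
  have hmin : ∀ τ, IsDensity τ → Fmin (krausMap K) ≤ ‖overlap K τ‖ := fun τ hτ =>
    hleast.2 (by rw [fidelities_krausMap]; exact ⟨τ, hτ, rfl⟩)
  obtain ⟨ρ, hρ, hρF⟩ : ∃ ρ, IsDensity ρ ∧ ‖overlap K ρ‖ = Fmin (krausMap K) := by
    have := hleast.1
    rw [fidelities_krausMap] at this
    exact this
  have hn : NeZero n := ⟨by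
    rintro rfl
    have := hρ.2
    simp at this⟩
  -- An ancilla of dimension `d` suffices; `d = 0` would make every overlap vanish.
  obtain ⟨m, rfl⟩ : ∃ m, d = m + 1 := Nat.exists_eq_succ_of_ne_zero (by
    rintro rfl
    rw [← hρF, Subsingleton.elim (overlap K ρ) 0, norm_zero] at hF
    exact hF.false)
  obtain ⟨hF1, U, hU, hcost⟩ := exists_unitaryExtension hK hρ (hρF ▸ hF)
    (fun τ hτ => hρF ▸ hmin τ hτ)
  rw [hρF] at hF1 hcost
  have hlow : ∀ t ∈ extensionCosts (krausMap K), Real.arccos (Fmin (krausMap K)) ≤ t := by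
    rintro t ⟨m', U', hU', rfl⟩
    rw [← Real.arccos_cos (unitaryCost_nonneg U') (unitaryCost_le_pi U'), ← hρF]
    exact Real.antitone_arccos (cos_unitaryCost_le_norm_overlap hU' hρ)
  have hleast' : IsLeast (extensionCosts (krausMap K)) (Real.arccos (Fmin (krausMap K))) :=
    ⟨⟨m, U, hU, le_antisymm (hlow _ ⟨m, U, hU, rfl⟩) hcost⟩, hlow⟩
  have hcc : channelCost (krausMap K) = Real.arccos (Fmin (krausMap K)) := hleast'.csInf_eq
  refine ⟨hleast, hcc ▸ hleast', ?_, ?_⟩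
  · rw [hcc, Real.cos_arccos (by linarith) hF1]
  · intro k Ψ hΨ hopt
    rw [inOutFidelity_krausMap K hΨ] at hopt
    rw [← hopt] at hF hmin ⊢
    exact isLeast_re_expect_optWeight hΨ hF hmin
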